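/- Let $n\ge 0$, and let $D_n$ be the set of Dyck paths of order $n$, that is, lattice paths from $(0,0)$ to $(n,n)$ with $n$ north steps and $n$ east steps that never pass below the line $y=x$. Order $D_n$ by letting $d\le e$ if $d$ lies entirely below $e$ (the two paths may coincide at some points). A maximal chain of $D_n$ is a totally ordered subset of $D_n$ to which no further element can be added. A standard Young tableau of a shape with $N$ cells is a filling of its cells with $1,2,\ldots,N$, each used exactly once, which increases along each row (from left to right) and down each column. The poset $D_n$ has a least element, and the cells of the $n\times n$ grid that lie above this minimal path form the staircase Young diagram with row lengths $(n-1,n-2,\ldots,1)$ (empty if $n\le 1$), which has $\binom n2$ cells. The maximal chains of $D_n$ are in bijection with the standard Young tableaux of this staircase shape; in particular there are equally many of both, and their number is $$\frac{\binom{n}{2}!}{\prod_{i=1}^{n-1}(2i-1)^{\,n-i}},$$ where the empty product (for $n\le 1$) is $1$. -/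

import Mathlib

/-- A Dyck path of order `n`: a lattice path from `(0, 0)` to `(n, n)` with `n` north steps
(the letter `U`) and `n` east steps (the letter `D`) that never passes below the line `y = x`,
i.e. every prefix has at least as many north steps as east steps. -/
@[ext]
structure DyckPath (n : ℕ) where
  word : DyckWord
  semilength_eq : word.semilength = n

namespace DyckPath

variable {n : ℕ}

/-- The ordinate of the point that the path reaches after `k` steps, for `k ≤ 2 * n`. That point
is `(k - d.height k, d.height k)`, the only point of the path on the antidiagonal `x + y = k`. -/
def height (d : DyckPath n) (k : ℕ) : ℕ :=
  (d.word.toList.take k).count DyckStep.U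

theorem length_word (d : DyckPath n) : d.word.toList.length = 2 * n := by
  rw [← d.word.two_mul_semilength_eq_length, d.semilength_eq]

theorem eq_of_height_eq {d e : DyckPath n} (h : ∀ k, d.height k = e.height k) : d = e := by
  apply DyckPath.ext
  apply DyckWord.ext
  apply List.ext_getElem (by rw [d.length_word, e.length_word])
  intro k h₁ h₂
  have hk := h k
  have hk1 := h (k + 1)
  unfold height at hk hk1
  rw [List.take_succ_eq_append_getElem h₁, List.take_succ_eq_append_getElem h₂,
    List.count_append, List.count_append, hk] at hk1
  cases ha : d.word.toList[k] <;> cases hb : e.word.toList[k] <;> simp_all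

/-- The poset of Dyck paths of order `n`: `d ≤ e` iff `d` lies entirely below `e` (the paths may
touch), i.e. on every antidiagonal the point of `d` is not above the point of `e`. -/
instance : PartialOrder (DyckPath n) where
  le d e := ∀ k, d.height k ≤ e.height k
  le_refl _ _ := le_rfl
  le_trans _ _ _ h₁ h₂ k := (h₁ k).trans (h₂ k)
  le_antisymm _ _ h₁ h₂ := eq_of_height_eq fun k => (h₁ k).antisymm (h₂ k)

/-- The cells of the `n × n` grid that lie above the path `d`. Cells are pairs `(i, j)` of a row
`i` and a column `j`, numbered from `0`, rows from top to bottom and columns from left to right.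
So `(i, j)` is the unit square with lower right corner `(j + 1, n - 1 - i)`; it lies above the path
iff that corner is not below the point of the path on the antidiagonal `x + y = n + j - i`. -/
def cellsAbove (d : DyckPath n) : Finset (ℕ × ℕ) :=
  (Finset.range n ×ˢ Finset.range n).filter
    fun c => d.height (n + c.2 - c.1) + c.1 + 1 ≤ n

end DyckPath

/-- The staircase Young diagram with row lengths `n - 1, n - 2, …, 1` from top to bottom
(empty for `n ≤ 1`). -/
def staircase (n : ℕ) : YoungDiagram :=
  YoungDiagram.ofRowLens ((List.range (n - 1)).map fun i => n - 1 - i) (by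
    rw [List.sortedGE_iff_pairwise, List.pairwise_map]
    exact List.pairwise_lt_range.imp fun h => by omega)

theorem mem_staircase {n : ℕ} {c : ℕ × ℕ} : c ∈ staircase n ↔ c.1 + c.2 + 1 < n := by
  simp only [staircase, YoungDiagram.mem_ofRowLens, List.length_map, List.length_range,
    List.getElem_map, List.getElem_range, exists_prop]
  omega

/-- A standard Young tableau of shape `μ`: a filling of the cells of `μ` with the integers
`1, …, μ.card`, each used exactly once, increasing along rows (from left to right) and along
columns (from top to bottom). Entries outside `μ` are `0`, so that a tableau is determined by its
entries in `μ`. -/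
@[ext]
structure StandardYoungTableau (μ : YoungDiagram) where
  entry : ℕ → ℕ → ℕ
  row_strict : ∀ {i j₁ j₂ : ℕ}, j₁ < j₂ → (i, j₂) ∈ μ → entry i j₁ < entry i j₂
  col_strict : ∀ {i₁ i₂ j : ℕ}, i₁ < i₂ → (i₂, j) ∈ μ → entry i₁ j < entry i₂ j
  bijOn : Set.BijOn (fun c : ℕ × ℕ => entry c.1 c.2) (μ.cells : Set (ℕ × ℕ)) (Set.Icc 1 μ.card)
  zeros : ∀ {i j : ℕ}, (i, j) ∉ μ → entry i j = 0

/-- The maximal chains of a poset: totally ordered subsets to which no element can be added. -/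
abbrev MaximalChain (P : Type*) [PartialOrder P] : Type _ :=
  {C : Set P // IsMaxChain (· ≤ ·) C}

/-! The cells above a Dyck path form a Young diagram inside the staircase, and raising the path
removes cells. So `DyckPath n` is anti-isomorphic to the interval from the empty diagram to the
staircase in Young's lattice (`DyckPath.orderIsoIic`), and reversing the order keeps maximal chains.
The interval is graded by the number of cells, so a maximal chain adds one cell at a time; recording
when each cell is added gives a standard Young tableau (`StandardYoungTableau.equivMaximalChain`).

The tableaux are counted by Frobenius' formula |μ|! · det (1 / (l i - j)!), with l the shifted row
lengths (`card_standardYoungTableau_eq_det`). Both sides obey the same branching rule: a tableau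
loses its largest entry, which sits in a corner (`StandardYoungTableau.card_eq_sum_eraseCorner`),
while weighting row i of the matrix by l i - j lowers l i by one
(`sum_det_frobeniusMatrix_updateRow`). For the staircase l i = 2 i, and the determinant becomes a
Vandermonde determinant up to row factors (`det_frobeniusMatrix_two_mul`). -/

/-! ### Frobenius' determinant: branching rule and special values. -/

open Finset in
/-- Multiplying the columns of a matrix by weights, one row at a time, acts on the determinant as
a derivation. -/
theorem Matrix.sum_det_updateRow_mul {ι R : Type*} [Fintype ι] [DecidableEq ι] [CommRing R]
    (A : Matrix ι ι R) (c : ι → R) :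
    ∑ i, (A.updateRow i fun j => c j * A i j).det = (∑ j, c j) * A.det := by
  -- The Leibniz term of `σ` meets row `i` only in column `σ⁻¹ i`, so it gains the single factor `c
  -- (σ⁻¹ i)`; over all `i` these factors add up to `∑ j, c j`.
  have key : ∀ (σ : Equiv.Perm ι) (i : ι),
      ∏ j, (A.updateRow i fun j => c j * A i j) (σ j) j = c (σ⁻¹ i) * ∏ j, A (σ j) j := by
    intro σ i
    rw [← mul_prod_erase univ _ (mem_univ (σ⁻¹ i)),
      ← mul_prod_erase univ (fun j => A (σ j) j) (mem_univ (σ⁻¹ i)), ← mul_assoc]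
    congr 1
    · simp
    · refine prod_congr rfl fun j hj => ?_
      rw [Matrix.updateRow_ne]
      rintro rfl
      simp at hj
  simp only [Matrix.det_apply', key]
  rw [sum_comm, mul_sum]
  refine sum_congr rfl fun σ _ => ?_
  rw [← mul_sum, ← sum_mul, Equiv.sum_comp σ⁻¹ c]
  ring

/-- The matrix with entries `1 / (l i - j)!`, understood as `0` for `l i < j`. Its determinant is
Frobenius' expression for the number of standard Young tableaux divided by the factorial of the
number of cells. -/
def frobeniusMatrix {k : ℕ} (l : Fin k → ℕ) : Matrix (Fin k) (Fin k) ℚ :=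
  Matrix.of fun i j => ((l i).descFactorial j : ℚ) / (l i).factorial

theorem frobeniusMatrix_apply {k : ℕ} (l : Fin k → ℕ) (i j : Fin k) :
    frobeniusMatrix l i j = ((l i).descFactorial j : ℚ) / (l i).factorial := rfl

/-- This is 1 / (a - j)! = (a + 1 - j) / (a + 1 - j)!. With descending factorials it needs no bound
on `j`: at `j = a + 1` the factor vanishes, beyond that both quotients do. -/
theorem descFactorial_div_factorial_pred (a j : ℕ) :
    ((a.descFactorial j : ℚ) / a.factorial) =
      ((a : ℚ) + 1 - j) * (((a + 1).descFactorial j : ℚ) / (a + 1).factorial) := by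
  have h1 : ((a + 1 : ℕ) : ℚ) - j = (a : ℚ) + 1 - j := by push_cast; ring
  have h : ((a + 1 : ℚ) - j) * ((a + 1).descFactorial j : ℚ) = (a + 1) * a.descFactorial j := by
    have h2 := Nat.descFactorial_succ (a + 1) j
    rw [Nat.succ_descFactorial_succ] at h2
    rcases le_or_gt j (a + 1) with hj | hj
    · have h3 : (((a + 1) * a.descFactorial j : ℕ) : ℚ) =
          ((a + 1 - j : ℕ) : ℚ) * (a + 1).descFactorial j := by rw [h2]; push_cast; rfl
      rw [Nat.cast_sub hj] at h3
      push_cast at h3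
      exact h3.symm
    · rw [Nat.descFactorial_eq_zero_iff_lt.2 hj,
        Nat.descFactorial_eq_zero_iff_lt.2 (show a < j by omega)]
      simp
  rw [Nat.factorial_succ, ← mul_div_assoc, h]
  push_cast
  have : (a.factorial : ℚ) ≠ 0 := by exact_mod_cast a.factorial_ne_zero
  have : (a : ℚ) + 1 ≠ 0 := by positivity
  field_simp

/-- Frobenius' determinant satisfies the branching rule. -/
theorem sum_det_frobeniusMatrix_updateRow {k : ℕ} (l : Fin k → ℕ) :
    ∑ i, ((frobeniusMatrix l).updateRow i fun j => ((l i : ℚ) - j) * frobeniusMatrix l i j).det =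
      (∑ i, ((l i : ℚ) - i)) * (frobeniusMatrix l).det := by
  -- Split the weight `l i - j`: the part `l i` is constant along row `i` and scales the
  -- determinant; the part `-j` depends on the column only, so the derivation identity applies to
  -- it.
  have h : ∀ i, ((frobeniusMatrix l).updateRow i
      fun j => ((l i : ℚ) - j) * frobeniusMatrix l i j).det =
      l i * (frobeniusMatrix l).det + ((frobeniusMatrix l).updateRow i
        fun j => (-(j : ℚ)) * frobeniusMatrix l i j).det := by
    intro i
    have : (fun j : Fin k => ((l i : ℚ) - j) * frobeniusMatrix l i j) =
        (l i : ℚ) • frobeniusMatrix l i + fun j : Fin k => (-(j : ℚ)) * frobeniusMatrix l i j := by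
      ext j
      simp only [Pi.add_apply, Pi.smul_apply, smul_eq_mul]
      ring
    rw [this, Matrix.det_updateRow_add, Matrix.det_updateRow_smul, Matrix.updateRow_eq_self]
  rw [Finset.sum_congr rfl fun i _ => h i, Finset.sum_add_distrib,
    Matrix.sum_det_updateRow_mul (frobeniusMatrix l) fun j => -(j : ℚ), ← Finset.sum_mul, ← add_mul,
    Finset.sum_sub_distrib, Finset.sum_neg_distrib, sub_eq_add_neg]

/-- The case of the empty diagram, whose shifted row lengths are 0, …, k - 1: the matrix is lower
unitriangular. -/
theorem det_frobeniusMatrix_val (k : ℕ) :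
    (frobeniusMatrix fun i : Fin k => (i : ℕ)).det = 1 := by
  rw [Matrix.det_of_isLowerTriangular]
  · refine Finset.prod_eq_one fun i _ => ?_
    rw [frobeniusMatrix_apply, Nat.descFactorial_self, div_self]
    exact_mod_cast Nat.factorial_ne_zero _
  · intro i j hij
    rw [frobeniusMatrix_apply, Nat.descFactorial_eq_zero_iff_lt.2 (by simpa using hij)]
    simp

theorem det_vandermonde_two_mul (n : ℕ) :
    (Matrix.vandermonde fun i : Fin n => 2 * (i : ℚ)).det =
      ∏ i ∈ Finset.range n, ((2 : ℚ) ^ i * i.factorial) := by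
  have h : (Matrix.vandermonde fun i : Fin n => 2 * (i : ℚ)) =
      Matrix.of fun i j : Fin n =>
        (2 : ℚ) ^ (j : ℕ) * Matrix.vandermonde (fun i : Fin n => (i : ℚ)) i j := by
    ext i j
    simp [Matrix.vandermonde_apply, mul_pow]
  rw [h, Matrix.det_mul_row (fun j : Fin n => (2 : ℚ) ^ (j : ℕ)), Finset.prod_mul_distrib,
    Fin.prod_univ_eq_prod_range fun i => (2 : ℚ) ^ i]
  congr 1
  cases n with
  | zero => simp
  | succ n =>
    rw [Matrix.det_vandermonde_id_eq_superFactorial, ← Nat.prod_range_succ_factorial]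
    push_cast
    rfl

/-- After 1 / (2i)! is taken out of row `i`, column `j` holds the values at 2i of a monic polynomial
of degree `j`, so the determinant is that of Vandermonde. -/
theorem det_frobeniusMatrix_two_mul (n : ℕ) :
    (frobeniusMatrix fun i : Fin n => 2 * (i : ℕ)).det =
      ∏ i ∈ Finset.range n, ((2 : ℚ) ^ i * i.factorial / (2 * i).factorial) := by
  have h : (frobeniusMatrix fun i : Fin n => 2 * (i : ℕ)) = Matrix.of fun i j : Fin n =>
      (((2 * (i : ℕ)).factorial : ℚ)⁻¹) *
        (Matrix.of fun i j : Fin n => (descPochhammer ℚ j).eval (2 * (i : ℚ))) i j := by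
    ext i j
    have := descPochhammer_eval_eq_descFactorial ℚ (2 * (i : ℕ)) j
    push_cast at this
    simp only [Matrix.of_apply, frobeniusMatrix_apply, this]
    rw [div_eq_inv_mul]
  rw [h, Matrix.det_mul_column (fun i : Fin n => (((2 * (i : ℕ)).factorial : ℚ)⁻¹)),
    ← Matrix.det_eval_matrixOfPolynomials_eq_det_vandermonde _ (fun j : Fin n => descPochhammer ℚ j)
      (fun i => descPochhammer_natDegree ℚ i) (fun i => monic_descPochhammer ℚ i),
    det_vandermonde_two_mul,
    Fin.prod_univ_eq_prod_range fun i => (((2 * i).factorial : ℚ)⁻¹), ← Finset.prod_mul_distrib]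
  refine Finset.prod_congr rfl fun i _ => ?_
  rw [div_eq_inv_mul]

theorem two_pow_mul_factorial_div (n : ℕ) :
    (2 : ℚ) ^ n * n.factorial / (2 * n).factorial =
      (∏ i ∈ Finset.Icc 1 n, (2 * (i : ℚ) - 1))⁻¹ := by
  induction n with
  | zero => simp
  | succ n ih =>
    rw [Finset.prod_Icc_succ_top (by omega), mul_inv, ← ih, show 2 * (n + 1) = 2 * n + 1 + 1 by ring,
      Nat.factorial_succ, Nat.factorial_succ, Nat.factorial_succ]
    push_cast
    have h1 : ((2 * n).factorial : ℚ) ≠ 0 := by exact_mod_cast Nat.factorial_ne_zero _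
    have h2 : 2 * (n : ℚ) + 1 ≠ 0 := by positivity
    have h3 : (n : ℚ) + 1 ≠ 0 := by positivity
    rw [show 2 * ((n : ℚ) + 1) - 1 = 2 * n + 1 by ring,
      show 2 * (n : ℚ) + 1 + 1 = 2 * (n + 1) by ring]
    field_simp
    ring

/-- The factors on the left are inverse double factorials, and 2i - 1 divides out of those with
index i, …, n - 1, hence n - i times. -/
theorem prod_two_pow_mul_factorial_div (n : ℕ) :
    ∏ i ∈ Finset.range n, ((2 : ℚ) ^ i * i.factorial / (2 * i).factorial) =
      (∏ i ∈ Finset.Icc 1 (n - 1), (2 * (i : ℚ) - 1) ^ (n - i))⁻¹ := by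
  induction n with
  | zero => simp
  | succ n ih =>
    rw [Finset.prod_range_succ, ih, two_pow_mul_factorial_div, ← mul_inv]
    congr 1
    have h : ∏ i ∈ Finset.Icc 1 (n - 1), (2 * (i : ℚ) - 1) ^ (n - i) =
        ∏ i ∈ Finset.Icc 1 n, (2 * (i : ℚ) - 1) ^ (n - i) := by
      refine Finset.prod_subset (Finset.Icc_subset_Icc_right (by omega)) fun i hi hi' => ?_
      rw [Finset.mem_Icc] at hi hi'
      rw [show n - i = 0 by omega, pow_zero]
    rw [h, Nat.add_sub_cancel, ← Finset.prod_mul_distrib]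
    refine Finset.prod_congr rfl fun i hi => ?_
    rw [Finset.mem_Icc] at hi
    rw [show n + 1 - i = n - i + 1 by omega, pow_succ]

/-! ### Maximal chains in graded posets and in Young's lattice. -/

/-- In a poset with a rank function for which every nontrivial interval starts with a step of
rank one, the maximal chains are the chains that attain every rank. -/
theorem isMaxChain_iff_forall_rank {P : Type*} [PartialOrder P] [BoundedOrder P] {r : P → ℕ}
    (hr : StrictMono r) (hstep : ∀ x y : P, x < y → ∃ z, x < z ∧ z ≤ y ∧ r z = r x + 1)
    {C : Set P} :
    IsMaxChain (· ≤ ·) C ↔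
      IsChain (· ≤ ·) C ∧ ∀ k, r ⊥ ≤ k → k ≤ r ⊤ → ∃ x ∈ C, r x = k := by
  constructor
  · intro hC
    refine ⟨hC.1, fun k hk hk' => ?_⟩
    by_contra! hne
    have hmem : ∀ z, (∀ y ∈ C, z ≤ y ∨ y ≤ z) → z ∈ C := by
      intro z hz
      have := hC.2 (hC.1.insert fun y hy _ => hz y hy) (Set.subset_insert z C)
      rw [this]
      exact Set.mem_insert z C
    have hcmp : ∀ {x y}, x ∈ C → y ∈ C → r x < r y → x < y := by
      intro x y hx hy hxy
      have hne : x ≠ y := by rintro rfl; exact lt_irrefl _ hxy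
      rcases hC.1 hx hy hne with h | h
      · exact lt_of_le_of_ne h hne
      · exact absurd (hr.monotone h) (not_le.2 hxy)
    have hle : ∀ {x y}, x ∈ C → y ∈ C → r x ≤ r y → x ≤ y := by
      intro x y hx hy hxy
      by_cases hne : x = y
      · exact hne.le
      · rcases hC.1 hx hy hne with h | h
        · exact h
        · exact absurd (hr (lt_of_le_of_ne h (Ne.symm hne))) (not_lt.2 hxy)
    have hbot : r ⊥ < k := lt_of_le_of_ne hk (hne ⊥ hC.bot_mem)
    have htop : k < r ⊤ := lt_of_le_of_ne hk' (hne ⊤ hC.top_mem).symm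
    -- If rank `k` is missed, let `x` and `y` be the members of `C` nearest to it from below and
    -- above. A step of rank one from `x` towards `y` is comparable to all of `C`, hence lies in
    -- `C`, against the choice of `x`.
    obtain ⟨x, ⟨hxC, hxk⟩, hx⟩ : ∃ x, (x ∈ C ∧ r x < k) ∧ ∀ y, y ∈ C → r y < k → r y ≤ r x := by
      have hfin : (r '' {x | x ∈ C ∧ r x < k}).Finite :=
        (Set.finite_lt_nat k).subset (by rintro _ ⟨x, hx, rfl⟩; exact hx.2)
      obtain ⟨m, ⟨x, hx, rfl⟩, hm⟩ := hfin.exists_maximal ⟨_, ⊥, ⟨hC.bot_mem, hbot⟩, rfl⟩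
      exact ⟨x, hx, fun y hy hyk => (le_total (r y) (r x)).elim id
        fun h => hm ⟨y, ⟨hy, hyk⟩, rfl⟩ h⟩
    obtain ⟨y, ⟨hyC, hyk⟩, hy⟩ : ∃ y, (y ∈ C ∧ k < r y) ∧ ∀ z, z ∈ C → k < r z → r y ≤ r z := by
      obtain ⟨y, hy, hm⟩ := (measure r).wf.has_min {x | x ∈ C ∧ k < r x} ⟨⊤, hC.top_mem, htop⟩
      exact ⟨y, hy, fun z hz hzk => not_lt.1 (hm z ⟨hz, hzk⟩)⟩
    obtain ⟨z, hxz, hzy, hz⟩ := hstep x y (hcmp hxC hyC (hxk.trans hyk))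
    have hzC : z ∈ C := by
      refine hmem z fun w hw => ?_
      rcases lt_or_gt_of_ne (hne w hw) with h | h
      · exact Or.inr ((hle hw hxC (hx w hw h)).trans hxz.le)
      · exact Or.inl (hzy.trans (hle hyC hw (hy w hw h)))
    have h1 := hx z hzC
    have h2 := hne z hzC
    omega
  · rintro ⟨hC, h⟩
    refine ⟨hC, fun D hD hCD => hCD.antisymm fun x hx => ?_⟩
    obtain ⟨y, hy, hyx⟩ := h (r x) (hr.monotone bot_le) (hr.monotone le_top)
    suffices x = y by rwa [this]
    by_contra hne
    rcases hD hx (hCD hy) hne with h | h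
    · exact (hr (lt_of_le_of_ne h hne)).ne hyx.symm
    · exact (hr (lt_of_le_of_ne h (Ne.symm hne))).ne hyx

namespace YoungDiagram

theorem card_strictMono : StrictMono YoungDiagram.card :=
  fun _ _ h => Finset.card_lt_card (cells_ssubset_iff.2 h)

theorem eq_of_le_of_card_le {μ ν : YoungDiagram} (h : μ ≤ ν) (h' : ν.card ≤ μ.card) : μ = ν :=
  h.eq_of_not_lt fun hlt => (card_strictMono hlt).not_ge h'

/-- A cell of `ν` outside `μ` with least coordinate sum has all its predecessors in `μ`, so it can
be added. -/
theorem exists_le_card_eq_add_one {μ ν : YoungDiagram} (h : μ < ν) :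
    ∃ ρ : YoungDiagram, μ < ρ ∧ ρ ≤ ν ∧ ρ.card = μ.card + 1 := by
  obtain ⟨c, hc, hmin⟩ := (ν.cells \ μ.cells).exists_min_image (fun c => c.1 + c.2)
    (Finset.sdiff_nonempty.2 (cells_ssubset_iff.2 h).not_subset)
  rw [Finset.mem_sdiff] at hc
  have hlow : IsLowerSet ((insert c μ.cells : Finset (ℕ × ℕ)) : Set (ℕ × ℕ)) := by
    intro a b hba ha
    simp only [Finset.coe_insert, Set.mem_insert_iff, Finset.mem_coe] at ha ⊢
    rcases ha with rfl | ha
    · by_cases hb : b ∈ μ.cells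
      · exact Or.inr hb
      · left
        have h1 := hmin b (Finset.mem_sdiff.2 ⟨ν.isLowerSet hba hc.1, hb⟩)
        have h2 := hba.1
        have h3 := hba.2
        ext <;> omega
    · exact Or.inr (μ.isLowerSet hba ha)
  have hcard : (⟨insert c μ.cells, hlow⟩ : YoungDiagram).card = μ.card + 1 :=
    Finset.card_insert_of_notMem hc.2
  refine ⟨⟨insert c μ.cells, hlow⟩, ?_, ?_, hcard⟩
  · exact cells_ssubset_iff.1 (Finset.ssubset_insert hc.2)
  · exact cells_subset_iff.1
      (Finset.insert_subset hc.1 (cells_subset_iff.2 h.le))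

theorem isMaxChain_Iic_iff {μ : YoungDiagram} {C : Set (Set.Iic μ)} :
    IsMaxChain (· ≤ ·) C ↔
      IsChain (· ≤ ·) C ∧ ∀ k ≤ μ.card, ∃ ν ∈ C, ν.1.card = k := by
  rw [isMaxChain_iff_forall_rank (r := fun ν : Set.Iic μ => ν.1.card)]
  · have h1 : ((⊥ : Set.Iic μ) : YoungDiagram).card = 0 := rfl
    have h2 : ((⊤ : Set.Iic μ) : YoungDiagram).card = μ.card := rfl
    simp only [h1, h2, zero_le, forall_const]
  · exact fun ν ρ h => card_strictMono h
  · intro ν ρ h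
    obtain ⟨σ, h1, h2, h3⟩ := exists_le_card_eq_add_one (show ν.1 < ρ.1 from h)
    exact ⟨⟨σ, h2.trans ρ.2⟩, h1, h2, h3⟩

end YoungDiagram

/-! ### Standard Young tableaux as maximal chains of diagrams. -/

namespace StandardYoungTableau

variable {μ : YoungDiagram}

theorem entry_mono (T : StandardYoungTableau μ) {a b : ℕ × ℕ} (hab : a ≤ b) (hb : b ∈ μ) :
    T.entry a.1 a.2 ≤ T.entry b.1 b.2 := by
  have hb' : (b.1, a.2) ∈ μ := μ.up_left_mem le_rfl hab.2 hb
  refine le_trans (?_ : _ ≤ T.entry b.1 a.2) ?_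
  · rcases hab.1.eq_or_lt with h | h
    · rw [h]
    · exact (T.col_strict h hb').le
  · rcases hab.2.eq_or_lt with h | h
    · rw [h]
    · exact (T.row_strict h hb).le

/-- The cells of a standard Young tableau whose entries are at most `k`. -/
def sublevel (T : StandardYoungTableau μ) (k : ℕ) : YoungDiagram where
  cells := μ.cells.filter fun c => T.entry c.1 c.2 ≤ k
  isLowerSet a b hba ha := by
    simp only [Finset.coe_filter, Set.mem_ofPred_eq, YoungDiagram.mem_cells] at ha ⊢
    exact ⟨μ.isLowerSet hba ha.1, (T.entry_mono hba ha.1).trans ha.2⟩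

theorem mem_sublevel {T : StandardYoungTableau μ} {k : ℕ} {c : ℕ × ℕ} :
    c ∈ T.sublevel k ↔ c ∈ μ ∧ T.entry c.1 c.2 ≤ k := by
  rw [← YoungDiagram.mem_cells, sublevel, Finset.mem_filter, YoungDiagram.mem_cells]

theorem sublevel_le (T : StandardYoungTableau μ) (k : ℕ) : T.sublevel k ≤ μ :=
  fun _ hc => (mem_sublevel.1 hc).1

theorem sublevel_mono (T : StandardYoungTableau μ) : Monotone T.sublevel :=
  fun _ _ h _ hc => mem_sublevel.2 ⟨(mem_sublevel.1 hc).1, (mem_sublevel.1 hc).2.trans h⟩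

theorem card_sublevel (T : StandardYoungTableau μ) {k : ℕ} (hk : k ≤ μ.card) :
    (T.sublevel k).card = k := by
  have h : (T.sublevel k).cells.image (fun c => T.entry c.1 c.2) = Finset.Icc 1 k := by
    ext m
    simp only [Finset.mem_image, YoungDiagram.mem_cells, mem_sublevel, Finset.mem_Icc]
    constructor
    · rintro ⟨c, ⟨hc, hck⟩, rfl⟩
      exact ⟨(T.bijOn.mapsTo hc).1, hck⟩
    · rintro ⟨h1, h2⟩
      obtain ⟨c, hc, rfl⟩ := T.bijOn.surjOn (⟨h1, h2.trans hk⟩ : m ∈ Set.Icc 1 μ.card)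
      exact ⟨c, ⟨hc, h2⟩, rfl⟩
  rw [YoungDiagram.card, ← Finset.card_image_of_injOn (T.bijOn.injOn.mono
    (YoungDiagram.cells_subset_iff.2 (T.sublevel_le k))), h]
  simp

theorem entry_le_card (T : StandardYoungTableau μ) {c : ℕ × ℕ} (hc : c ∈ μ) :
    T.entry c.1 c.2 ≤ μ.card := (T.bijOn.mapsTo hc).2

/-- The diagrams of the cells with entries at most `k`, as `k` varies, form a maximal chain of
subdiagrams. -/
def maximalChain (T : StandardYoungTableau μ) : MaximalChain (Set.Iic μ) :=
  ⟨Set.range fun k => ⟨T.sublevel k, T.sublevel_le k⟩, by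
    rw [YoungDiagram.isMaxChain_Iic_iff]
    constructor
    · rintro _ ⟨k, rfl⟩ _ ⟨m, rfl⟩ -
      exact (le_total k m).imp (fun h => T.sublevel_mono h) fun h => T.sublevel_mono h
    · exact fun k hk => ⟨_, ⟨k, rfl⟩, T.card_sublevel hk⟩⟩

/-- A chain has at most one member of each cardinality, so it determines `T.sublevel k` for `k ≤
μ.card`; the entry of a cell is the first `k` whose sublevel contains it. -/
theorem maximalChain_injective :
    Function.Injective (maximalChain : StandardYoungTableau μ → MaximalChain (Set.Iic μ)) := by
  intro T T' h
  have hC : (T.maximalChain : Set (Set.Iic μ)) = T'.maximalChain := congrArg Subtype.val h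
  have hsub : ∀ k ≤ μ.card, T.sublevel k = T'.sublevel k := by
    intro k hk
    have hmem : (⟨T.sublevel k, T.sublevel_le k⟩ : Set.Iic μ) ∈
        (T'.maximalChain : Set (Set.Iic μ)) := hC ▸ ⟨k, rfl⟩
    obtain ⟨m, hm⟩ := hmem
    have hm' : T'.sublevel m = T.sublevel k := congrArg Subtype.val hm
    have hcard : (T'.sublevel k).card = (T'.sublevel m).card := by
      rw [hm', T.card_sublevel hk, T'.card_sublevel hk]
    rw [← hm']
    rcases le_total k m with h | h
    · exact (YoungDiagram.eq_of_le_of_card_le (T'.sublevel_mono h) hcard.ge).symm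
    · exact YoungDiagram.eq_of_le_of_card_le (T'.sublevel_mono h) hcard.le
  have hle : ∀ {S S' : StandardYoungTableau μ}, (∀ k ≤ μ.card, S.sublevel k = S'.sublevel k) →
      ∀ c ∈ μ, S'.entry c.1 c.2 ≤ S.entry c.1 c.2 := by
    intro S S' hS c hc
    have := mem_sublevel.2 ⟨hc, le_refl (S.entry c.1 c.2)⟩
    rw [hS _ (S.entry_le_card hc)] at this
    exact (mem_sublevel.1 this).2
  ext i j
  by_cases hc : (i, j) ∈ μ
  · exact le_antisymm (hle (fun k hk => (hsub k hk).symm) (i, j) hc) (hle hsub (i, j) hc)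
  · rw [T.zeros hc, T'.zeros hc]

/-- Fill each cell with the rank at which it first appears in the chain. -/
theorem maximalChain_surjective :
    Function.Surjective (maximalChain : StandardYoungTableau μ → MaximalChain (Set.Iic μ)) := by
  classical
  rintro ⟨C, hC⟩
  obtain ⟨hchain, hrank⟩ := YoungDiagram.isMaxChain_Iic_iff.1 hC
  -- Beyond rank `μ.card` the choice is unconstrained. This is harmless: every cell has appeared by
  -- rank `μ.card`.
  have hex : ∀ k, ∃ ν : Set.Iic μ, k ≤ μ.card → ν ∈ C ∧ ν.1.card = k := by
    intro k
    by_cases hk : k ≤ μ.card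
    · obtain ⟨ν, h1, h2⟩ := hrank k hk
      exact ⟨ν, fun _ => ⟨h1, h2⟩⟩
    · exact ⟨⊤, fun h => absurd h hk⟩
  choose f hf using hex
  have hmono : ∀ {k m}, k ≤ m → m ≤ μ.card → (f k).1 ≤ (f m).1 := by
    intro k m hkm hm
    by_cases hne : f k = f m
    · rw [hne]
    · rcases hchain (hf k (hkm.trans hm)).1 (hf m hm).1 hne with h | h
      · exact h
      · have h1 : (f m).1 ≤ (f k).1 := h
        have h2 := hf k (hkm.trans hm)
        have h3 := hf m hm
        exact (YoungDiagram.eq_of_le_of_card_le h1 (by omega)).ge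
  have htop : (f μ.card).1 = μ :=
    YoungDiagram.eq_of_le_of_card_le (f μ.card).2 (hf μ.card le_rfl).2.ge
  have hfind : ∀ c : ℕ × ℕ, c ∈ μ → ∃ k, c ∈ (f k).1 := fun c hc => ⟨μ.card, by rwa [htop]⟩
  let t : ℕ → ℕ → ℕ := fun i j => if h : (i, j) ∈ μ then Nat.find (hfind (i, j) h) else 0
  have ht : ∀ c : ℕ × ℕ, c ∈ μ → ∀ k ≤ μ.card, (t c.1 c.2 ≤ k ↔ c ∈ (f k).1) := by
    intro c hc k hk
    have htc : t c.1 c.2 = Nat.find (hfind c hc) := dif_pos hc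
    rw [htc]
    constructor
    · exact fun h => hmono h hk (Nat.find_spec (hfind c hc))
    · exact fun h => Nat.find_min' _ h
  have htle : ∀ c : ℕ × ℕ, c ∈ μ → t c.1 c.2 ≤ μ.card := fun c hc =>
    (ht c hc _ le_rfl).2 (by rwa [htop])
  have htpos : ∀ c : ℕ × ℕ, c ∈ μ → 1 ≤ t c.1 c.2 := by
    intro c hc
    by_contra! h
    have h1 := (ht c hc 0 (Nat.zero_le _)).1 (by omega)
    have h2 := (hf 0 (Nat.zero_le _)).2
    rw [YoungDiagram.card, Finset.card_eq_zero] at h2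
    rw [← YoungDiagram.mem_cells, h2] at h1
    simp at h1
  have hinj : ∀ c ∈ μ, ∀ c' ∈ μ, t c.1 c.2 = t c'.1 c'.2 → c = c' := by
    intro c hc c' hc' h
    obtain ⟨k, hk⟩ : ∃ k, t c.1 c.2 = k + 1 := ⟨t c.1 c.2 - 1, by have := htpos c hc; omega⟩
    have hkμ : k + 1 ≤ μ.card := hk ▸ htle c hc
    -- Cells with the same entry `k + 1` lie in the difference of two consecutive diagrams, which is
    -- a single cell.
    have hmem : ∀ b ∈ μ, t b.1 b.2 = k + 1 → b ∈ (f (k + 1)).1.cells \ (f k).1.cells := by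
      intro b hb hbk
      rw [Finset.mem_sdiff, YoungDiagram.mem_cells, YoungDiagram.mem_cells,
        ← ht b hb _ hkμ, ← ht b hb k (by omega)]
      omega
    have hcard : ((f (k + 1)).1.cells \ (f k).1.cells).card ≤ 1 := by
      rw [Finset.card_sdiff_of_subset (YoungDiagram.cells_subset_iff.2 (hmono (by omega) hkμ))]
      have h1 := (hf (k + 1) hkμ).2
      have h2 := (hf k (by omega)).2
      rw [YoungDiagram.card] at h1 h2
      omega
    exact Finset.card_le_one.1 hcard c (hmem c hc hk) c' (hmem c' hc' (h ▸ hk))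
  have hlemono : ∀ a b : ℕ × ℕ, a ≤ b → b ∈ μ → t a.1 a.2 ≤ t b.1 b.2 := by
    intro a b hab hb
    rw [ht a (μ.isLowerSet hab hb) _ (htle b hb)]
    exact (f _).1.isLowerSet hab ((ht b hb _ (htle b hb)).1 le_rfl)
  have hmaps : Set.MapsTo (fun c : ℕ × ℕ => t c.1 c.2) (μ.cells : Set (ℕ × ℕ))
      (Set.Icc 1 μ.card) := fun c hc => ⟨htpos c hc, htle c hc⟩
  have hinjOn : Set.InjOn (fun c : ℕ × ℕ => t c.1 c.2) (μ.cells : Set (ℕ × ℕ)) :=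
    fun c hc c' hc' h => hinj c hc c' hc' h
  let T : StandardYoungTableau μ :=
    { entry := t
      row_strict := by
        intro i j₁ j₂ hj h
        refine lt_of_le_of_ne (hlemono (i, j₁) (i, j₂) ⟨le_rfl, hj.le⟩ h) fun he => ?_
        have := hinj (i, j₁) (μ.up_left_mem le_rfl hj.le h) (i, j₂) h he
        simp only [Prod.mk.injEq, true_and] at this
        omega
      col_strict := by
        intro i₁ i₂ j hi h
        refine lt_of_le_of_ne (hlemono (i₁, j) (i₂, j) ⟨hi.le, le_rfl⟩ h) fun he => ?_
        have := hinj (i₁, j) (μ.up_left_mem hi.le le_rfl h) (i₂, j) h he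
        simp only [Prod.mk.injEq, and_true] at this
        omega
      bijOn := by
        refine ⟨hmaps, hinjOn, ?_⟩
        have hs := Finset.surjOn_of_injOn_of_card_le (s := μ.cells) (t := Finset.Icc 1 μ.card)
          (fun c : ℕ × ℕ => t c.1 c.2) (by simpa using hmaps) hinjOn (by simp)
        simpa using hs
      zeros := fun h => dif_neg h }
  have hT : ∀ k ≤ μ.card, T.sublevel k = (f k).1 := by
    intro k hk
    refine SetLike.ext fun c => ?_
    rw [mem_sublevel]
    constructor
    · exact fun h => (ht c h.1 k hk).1 h.2
    · exact fun h => ⟨(f k).2 h, (ht c ((f k).2 h) k hk).2 h⟩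
  refine ⟨T, Subtype.ext ?_⟩
  -- The chain of `T` is already maximal, so its inclusion in the chain `C` forces equality.
  refine T.maximalChain.2.2 hchain ?_
  rintro _ ⟨k, rfl⟩
  obtain ⟨m, hm, hkm⟩ : ∃ m ≤ μ.card, T.sublevel k = T.sublevel m := by
    rcases le_total k μ.card with hk | hk
    · exact ⟨k, hk, rfl⟩
    · refine ⟨μ.card, le_rfl, SetLike.ext fun c => ?_⟩
      rw [mem_sublevel, mem_sublevel]
      exact and_congr_right fun hc => ⟨fun _ => T.entry_le_card hc, fun h => h.trans hk⟩
  have hfm : f m = ⟨T.sublevel k, T.sublevel_le k⟩ := Subtype.ext ((hkm.trans (hT m hm)).symm)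
  have hmem := (hf m hm).1
  rw [hfm] at hmem
  exact hmem

/-- Standard Young tableaux correspond to the maximal chains of subdiagrams. -/
noncomputable def equivMaximalChain (μ : YoungDiagram) :
    StandardYoungTableau μ ≃ MaximalChain (Set.Iic μ) :=
  Equiv.ofBijective maximalChain ⟨maximalChain_injective, maximalChain_surjective⟩

end StandardYoungTableau

/-! ### Dyck paths as subdiagrams of the staircase. -/

/-- Turns a height function into a word. The bound `h k ≤ k` is carried through the induction to
control the truncated subtraction `k - h k`. -/
theorem count_U_take_map_range (h : ℕ → ℕ) (h0 : h 0 = 0)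
    (hstep : ∀ k, h (k + 1) = h k ∨ h (k + 1) = h k + 1) (N k : ℕ) (hk : k ≤ N) :
    ((((List.range N).map fun k => if h (k + 1) = h k then DyckStep.D else DyckStep.U).take k).count
      DyckStep.U = h k) ∧
    ((((List.range N).map fun k => if h (k + 1) = h k then DyckStep.D else DyckStep.U).take k).count
      DyckStep.D = k - h k) ∧ h k ≤ k := by
  rw [← List.map_take, List.take_range, min_eq_left hk]
  clear hk
  induction k with
  | zero => simp [h0]
  | succ k ih =>
    obtain ⟨h1, h2, h3⟩ := ih
    rw [List.range_succ, List.map_append, List.count_append, List.count_append, h1, h2]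
    rcases hstep k with hs | hs
    · simp [hs]
      omega
    · simp [hs]
      omega

namespace DyckPath

variable {n : ℕ}

theorem height_succ (d : DyckPath n) (k : ℕ) :
    d.height (k + 1) = d.height k ∨ d.height (k + 1) = d.height k + 1 := by
  unfold height
  rw [List.take_add_one, List.count_append]
  cases h : d.word.toList[k]? with
  | none => simp
  | some s => cases s <;> simp

theorem height_mono (d : DyckPath n) : Monotone d.height :=
  monotone_nat_of_le_succ fun k => by have := d.height_succ k; omega

theorem height_le (d : DyckPath n) (k : ℕ) : d.height k ≤ n := by
  have h := (List.take_sublist k d.word.toList).count_le DyckStep.U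
  have h' := d.semilength_eq
  rw [DyckWord.semilength] at h'
  exact h.trans h'.le

theorem height_of_le (d : DyckPath n) {k : ℕ} (hk : 2 * n ≤ k) : d.height k = n := by
  have h' := d.semilength_eq
  rw [DyckWord.semilength] at h'
  rw [height, List.take_of_length_le (by rw [d.length_word]; exact hk), h']

theorem le_two_mul_height (d : DyckPath n) {k : ℕ} (hk : k ≤ 2 * n) : k ≤ 2 * d.height k := by
  have h1 := d.word.count_D_le_count_U k
  have h2 : (d.word.toList.take k).length = k := by
    rw [List.length_take, d.length_word, min_eq_left hk]
  have h3 : ∀ l : List DyckStep, l.length = l.count DyckStep.U + l.count DyckStep.D := by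
    intro l
    induction l with
    | nil => rfl
    | cons s l ih => cases s <;> simp <;> omega
  rw [h3] at h2
  rw [height]
  omega

/-- A function with the properties of the height function of a Dyck path is the height function of
a Dyck path. -/
theorem exists_height_eq (h : ℕ → ℕ) (h0 : h 0 = 0)
    (hstep : ∀ k, h (k + 1) = h k ∨ h (k + 1) = h k + 1)
    (hdyck : ∀ k ≤ 2 * n, k ≤ 2 * h k) (hend : h (2 * n) = n) :
    ∃ d : DyckPath n, ∀ k ≤ 2 * n, d.height k = h k := by
  have key := count_U_take_map_range h h0 hstep (2 * n)
  set w := (List.range (2 * n)).map fun k => if h (k + 1) = h k then DyckStep.D else DyckStep.U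
    with hw
  have hlen : w.length = 2 * n := by simp [hw]
  have hU := (key (2 * n) le_rfl).1
  have hD := (key (2 * n) le_rfl).2.1
  rw [List.take_of_length_le hlen.le, hend] at hU hD
  have hle : ∀ k ≤ 2 * n, (w.take k).count DyckStep.D ≤ (w.take k).count DyckStep.U := by
    intro k hk
    rw [(key k hk).1, (key k hk).2.1]
    have := hdyck k hk
    omega
  let W : DyckWord := ⟨w, by omega, fun k => by
    rcases le_total k (2 * n) with hk | hk
    · exact hle k hk
    · have := hle (2 * n) le_rfl
      rw [List.take_of_length_le hlen.le] at this
      rwa [List.take_of_length_le (by omega)]⟩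
  exact ⟨⟨W, hU⟩, fun k hk => (key k hk).1⟩

theorem mem_cellsAbove {d : DyckPath n} {c : ℕ × ℕ} :
    c ∈ d.cellsAbove ↔ (c.1 < n ∧ c.2 < n) ∧ d.height (n + c.2 - c.1) + c.1 + 1 ≤ n := by
  simp [cellsAbove]

theorem add_lt_of_mem_cellsAbove {d : DyckPath n} {c : ℕ × ℕ} (hc : c ∈ d.cellsAbove) :
    c.1 + c.2 + 1 < n := by
  obtain ⟨⟨h1, h2⟩, h3⟩ := mem_cellsAbove.1 hc
  have := d.le_two_mul_height (k := n + c.2 - c.1) (by omega)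
  omega

/-- One cell up moves to the next antidiagonal, where the height gains at most 1 while the bound `n
- 1 - i` gains exactly 1. One cell left moves to the previous antidiagonal, where the height is no
larger. -/
theorem isLowerSet_cellsAbove (d : DyckPath n) :
    IsLowerSet (d.cellsAbove : Set (ℕ × ℕ)) := by
  have hrow : ∀ i j, (i + 1, j) ∈ d.cellsAbove → (i, j) ∈ d.cellsAbove := by
    intro i j h
    rw [mem_cellsAbove] at h ⊢
    obtain ⟨⟨h1, h2⟩, h3⟩ := h
    simp only at h1 h2 h3 ⊢
    have := d.height_succ (n + j - (i + 1))
    rw [show n + j - (i + 1) + 1 = n + j - i by omega] at this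
    omega
  have hcol : ∀ i j, (i, j + 1) ∈ d.cellsAbove → (i, j) ∈ d.cellsAbove := by
    intro i j h
    rw [mem_cellsAbove] at h ⊢
    obtain ⟨⟨h1, h2⟩, h3⟩ := h
    simp only at h1 h2 h3 ⊢
    have := d.height_mono (show n + j - i ≤ n + (j + 1) - i by omega)
    omega
  rintro ⟨i, j⟩ ⟨i', j'⟩ ⟨hi, hj⟩ h
  simp only at hi hj
  obtain ⟨a, rfl⟩ := Nat.exists_eq_add_of_le hi
  obtain ⟨b, rfl⟩ := Nat.exists_eq_add_of_le hj
  rw [Finset.mem_coe] at h ⊢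
  have h' : (i', j' + b) ∈ d.cellsAbove := by
    clear hi hj
    induction a with
    | zero => exact h
    | succ a ih => exact ih (hrow _ _ h)
  clear hi hj h
  induction b with
  | zero => exact h'
  | succ b ih => exact ih (hcol _ _ h')

theorem cellsAbove_subset_iff {d e : DyckPath n} : e.cellsAbove ⊆ d.cellsAbove ↔ d ≤ e := by
  constructor
  · intro h k
    by_contra! hlt
    have h1 := d.height_le k
    have hk : k < 2 * n := by
      by_contra! hk
      rw [e.height_of_le hk] at hlt
      omega
    have h2 := e.le_two_mul_height hk.le
    have h3 : e.height k ≤ k := (List.count_le_length).trans (by simp)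
    have h4 : d.height k ≤ k := (List.count_le_length).trans (by simp)
    -- The cell whose lower right corner is the point of `e` on the antidiagonal x + y = k; it lies
    -- above `e` but not above `d`.
    have hmem : (n - 1 - e.height k, k - 1 - e.height k) ∈ e.cellsAbove := by
      rw [mem_cellsAbove]
      simp only
      rw [show n + (k - 1 - e.height k) - (n - 1 - e.height k) = k by omega]
      omega
    have := (mem_cellsAbove.1 (h hmem)).2
    simp only at this
    rw [show n + (k - 1 - e.height k) - (n - 1 - e.height k) = k by omega] at this
    omega
  · intro h c hc
    rw [mem_cellsAbove] at hc ⊢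
    exact ⟨hc.1, by have := h (n + c.2 - c.1); omega⟩

/-- The Young diagram of the cells above a Dyck path. -/
def diagram (d : DyckPath n) : YoungDiagram := ⟨d.cellsAbove, d.isLowerSet_cellsAbove⟩

theorem diagram_le_staircase (d : DyckPath n) : d.diagram ≤ staircase n :=
  fun _ hc => mem_staircase.2 (add_lt_of_mem_cellsAbove hc)

theorem exists_diagram_eq {ν : YoungDiagram} (hν : ν ≤ staircase n) :
    ∃ d : DyckPath n, d.diagram = ν := by
  classical
  have hlt : ∀ i j, (i, j) ∈ ν → i + j + 1 < n := fun i j h => mem_staircase.1 (hν h)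
  have hwit : ∀ m, n ≤ m + n ∧ (n, m + n - n) ∉ ν :=
    fun m => ⟨by omega, fun h => by have := hlt _ _ h; omega⟩
  have hex : ∀ m, ∃ i, n ≤ m + i ∧ (i, m + i - n) ∉ ν := fun m => ⟨n, hwit m⟩
  -- The row in which the diagonal j - i = m - n leaves `ν`; the bound `n ≤ m + i` keeps the column
  -- nonnegative. The path sought has height `n - t m` after `m` steps.
  let t : ℕ → ℕ := fun m => Nat.find (hex m)
  have tspec : ∀ m, n ≤ m + t m ∧ (t m, m + t m - n) ∉ ν := fun m => Nat.find_spec (hex m)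
  have tmin : ∀ m i, n ≤ m + i → (i, m + i - n) ∉ ν → t m ≤ i :=
    fun m i h1 h2 => Nat.find_min' (hex m) ⟨h1, h2⟩
  have tle : ∀ m, t m ≤ n := fun m => tmin m n (hwit m).1 (hwit m).2
  have tanti : ∀ m, t (m + 1) ≤ t m := by
    intro m
    obtain ⟨h1, h2⟩ := tspec m
    exact tmin _ _ (by omega) fun h => h2 (ν.up_left_mem le_rfl (by omega) h)
  have tsucc : ∀ m, t m ≤ t (m + 1) + 1 := by
    intro m
    obtain ⟨h1, h2⟩ := tspec (m + 1)
    exact tmin _ _ (by omega) fun h => h2 (ν.up_left_mem (by omega) (by omega) h)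
  have tdyck : ∀ m ≤ 2 * n, 2 * t m + m ≤ 2 * n := by
    intro m hm
    -- In row n - ⌈m/2⌉ this diagonal is already outside the staircase.
    have := tmin m (n - (m + 1) / 2) (by omega) fun h => by have := hlt _ _ h; omega
    omega
  have t0 : n ≤ t 0 := by have := (tspec 0).1; omega
  obtain ⟨d, hd⟩ := exists_height_eq (n := n) (fun m => n - t m) (by omega)
    (fun m => by have := tanti m; have := tsucc m; have := tle m; omega)
    (fun m hm => by have := tdyck m hm; omega)
    (by have := tdyck (2 * n) le_rfl; omega)
  refine ⟨d, SetLike.ext fun ⟨i, j⟩ => ?_⟩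
  have hmem : (i, j) ∈ d.diagram ↔ (i, j) ∈ d.cellsAbove := Iff.rfl
  rw [hmem, mem_cellsAbove]
  simp only
  constructor
  · rintro ⟨⟨hi, hj⟩, h⟩
    rw [hd _ (by omega)] at h
    by_contra hc
    have := tmin (n + j - i) i (by omega) (by rwa [show n + j - i + i - n = j by omega])
    have := tle (n + j - i)
    omega
  · intro h
    have hij := hlt i j h
    refine ⟨by omega, ?_⟩
    rw [hd _ (by omega)]
    have hti : i < t (n + j - i) := by
      by_contra! hle
      obtain ⟨h1, h2⟩ := tspec (n + j - i)
      exact h2 (ν.up_left_mem hle (by omega) h)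
    have := tle (n + j - i)
    omega

/-- Dyck paths of order `n`, ordered from above to below, are the subdiagrams of the staircase. -/
noncomputable def orderIsoIic (n : ℕ) : (DyckPath n)ᵒᵈ ≃o Set.Iic (staircase n) :=
  RelIso.ofSurjective
    (OrderEmbedding.ofMapLEIff
      (fun d : (DyckPath n)ᵒᵈ => (⟨d.ofDual.diagram, d.ofDual.diagram_le_staircase⟩ :
        Set.Iic (staircase n)))
      fun _ _ => YoungDiagram.cells_subset_iff.symm.trans cellsAbove_subset_iff)
    fun ν => (exists_diagram_eq ν.2).imp fun _ h => Subtype.ext h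

theorem exists_isLeast_cellsAbove_eq (n : ℕ) :
    ∃ d : DyckPath n, IsLeast Set.univ d ∧ d.cellsAbove = (staircase n).cells := by
  obtain ⟨d, hd⟩ := exists_diagram_eq (le_refl (staircase n))
  have hd' : d.cellsAbove = (staircase n).cells := congrArg YoungDiagram.cells hd
  refine ⟨d, ⟨Set.mem_univ d, fun e _ => cellsAbove_subset_iff.1 ?_⟩, hd'⟩
  rw [hd']
  exact YoungDiagram.cells_subset_iff.2 e.diagram_le_staircase

/-- Maximal chains of Dyck paths correspond to maximal chains of subdiagrams of the staircase. -/
noncomputable def maximalChainEquiv (n : ℕ) :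
    MaximalChain (DyckPath n) ≃ MaximalChain (Set.Iic (staircase n)) where
  toFun C := ⟨_, (show IsMaxChain (· ≤ ·) (OrderDual.ofDual ⁻¹' C.1) from C.2.symm).image
    (orderIsoIic n)⟩
  invFun C := ⟨OrderDual.toDual ⁻¹' ((orderIsoIic n).symm '' C.1),
    (C.2.image (orderIsoIic n).symm).symm⟩
  left_inv C := Subtype.ext ((orderIsoIic n).toEquiv.symm_image_image (OrderDual.ofDual ⁻¹' C.1))
  right_inv C := Subtype.ext ((orderIsoIic n).toEquiv.image_symm_image C.1)

end DyckPath

/-! ### Corners of Young diagrams. -/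

namespace YoungDiagram

theorem fst_lt_of_mem {μ : YoungDiagram} {k : ℕ} (hk : μ.rowLen k = 0) {c : ℕ × ℕ} (hc : c ∈ μ) :
    c.1 < k := by
  by_contra! h
  have h1 := μ.rowLen_anti k c.1 h
  have h2 := mem_iff_lt_rowLen.1 (show (c.1, c.2) ∈ μ from hc)
  omega

theorem card_eq_sum_rowLen {μ : YoungDiagram} {k : ℕ} (hk : μ.rowLen k = 0) :
    μ.card = ∑ i ∈ Finset.range k, μ.rowLen i := by
  rw [YoungDiagram.card, Finset.card_eq_sum_card_fiberwise (f := Prod.fst) (t := Finset.range k)]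
  · exact Finset.sum_congr rfl fun i _ => (μ.rowLen_eq_card).symm
  · exact fun c hc => Finset.mem_coe.2 (Finset.mem_range.2 (fst_lt_of_mem hk hc))

/-- A Young diagram with the last cell of a row removed, when it is a corner. -/
def eraseCorner (μ : YoungDiagram) (i : ℕ) (h : μ.rowLen (i + 1) < μ.rowLen i) : YoungDiagram where
  cells := μ.cells.erase (i, μ.rowLen i - 1)
  isLowerSet a b hba ha := by
    simp only [Finset.coe_erase, Set.mem_sdiff, Finset.mem_coe, Set.mem_singleton_iff] at ha ⊢
    refine ⟨μ.isLowerSet hba ha.1, ?_⟩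
    rintro rfl
    have h1 := mem_iff_lt_rowLen.1 (show (a.1, a.2) ∈ μ from ha.1)
    have h2 : i ≤ a.1 := hba.1
    have h3 : μ.rowLen i - 1 ≤ a.2 := hba.2
    rcases h2.eq_or_lt with h4 | h4
    · refine ha.2 (Prod.ext h4.symm ?_)
      rw [← h4] at h1
      simp only
      omega
    · have := μ.rowLen_anti (i + 1) a.1 h4
      omega

theorem mem_eraseCorner {μ : YoungDiagram} {i : ℕ} {h : μ.rowLen (i + 1) < μ.rowLen i}
    {c : ℕ × ℕ} : c ∈ μ.eraseCorner i h ↔ c ∈ μ ∧ c ≠ (i, μ.rowLen i - 1) := by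
  rw [← mem_cells, eraseCorner, Finset.mem_erase, mem_cells, and_comm]

theorem corner_mem {μ : YoungDiagram} {i : ℕ} (h : μ.rowLen (i + 1) < μ.rowLen i) :
    (i, μ.rowLen i - 1) ∈ μ := mem_iff_lt_rowLen.2 (by omega)

theorem card_eraseCorner {μ : YoungDiagram} {i : ℕ} (h : μ.rowLen (i + 1) < μ.rowLen i) :
    (μ.eraseCorner i h).card + 1 = μ.card :=
  Finset.card_erase_add_one (corner_mem h)

theorem rowLen_eraseCorner {μ : YoungDiagram} {i : ℕ} (h : μ.rowLen (i + 1) < μ.rowLen i) (r : ℕ) :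
    (μ.eraseCorner i h).rowLen r = if r = i then μ.rowLen i - 1 else μ.rowLen r := by
  refine eq_of_forall_lt_iff fun j => ?_
  rw [← mem_iff_lt_rowLen, mem_eraseCorner, mem_iff_lt_rowLen]
  split_ifs with hr
  · subst hr
    simp only [ne_eq, Prod.mk.injEq, true_and]
    omega
  · simp [hr]

/-- A cell that is maximal in a Young diagram is a corner. -/
theorem corner_of_maximal {μ : YoungDiagram} {c : ℕ × ℕ} (hc : c ∈ μ)
    (hmax : ∀ a ∈ μ, c ≤ a → a = c) :
    μ.rowLen (c.1 + 1) < μ.rowLen c.1 ∧ c = (c.1, μ.rowLen c.1 - 1) := by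
  have h1 := mem_iff_lt_rowLen.1 (show (c.1, c.2) ∈ μ from hc)
  have h2 : c.2 = μ.rowLen c.1 - 1 := by
    have := congrArg Prod.snd
      (hmax (c.1, μ.rowLen c.1 - 1) (mem_iff_lt_rowLen.2 (by omega)) ⟨le_rfl, by simp only; omega⟩)
    simpa using this.symm
  refine ⟨?_, Prod.ext rfl h2⟩
  by_contra! h
  have := congrArg Prod.fst
    (hmax (c.1 + 1, c.2) (mem_iff_lt_rowLen.2 (by omega)) ⟨Nat.le_succ _, le_rfl⟩)
  simp at this

end YoungDiagram

/-! ### The branching rule for tableaux. -/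

namespace StandardYoungTableau

variable {μ : YoungDiagram}

/-- Every cell with the largest entry is a corner. -/
theorem corner_of_entry_eq_card (T : StandardYoungTableau μ) {c : ℕ × ℕ} (hc : c ∈ μ)
    (h : T.entry c.1 c.2 = μ.card) :
    μ.rowLen (c.1 + 1) < μ.rowLen c.1 ∧ c = (c.1, μ.rowLen c.1 - 1) :=
  YoungDiagram.corner_of_maximal hc fun _ ha hca => T.bijOn.injOn ha hc
    (le_antisymm ((T.entry_le_card ha).trans h.ge) (T.entry_mono hca ha))

theorem exists_entry_eq_card (T : StandardYoungTableau μ) (hμ : 0 < μ.card) :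
    ∃ c ∈ μ, T.entry c.1 c.2 = μ.card :=
  T.bijOn.surjOn (⟨hμ, le_rfl⟩ : μ.card ∈ Set.Icc 1 μ.card)

theorem entry_lt_card (T : StandardYoungTableau μ) {b c : ℕ × ℕ} (hb : b ∈ μ)
    (hT : T.entry b.1 b.2 = μ.card) (hc : c ∈ μ) (hcb : c ≠ b) : T.entry c.1 c.2 < μ.card :=
  lt_of_le_of_ne (T.entry_le_card hc) fun h => hcb (T.bijOn.injOn hc hb (h.trans hT.symm))

/-- Removing the corner with the largest entry. -/
def eraseMax (T : StandardYoungTableau μ) {i : ℕ} (h : μ.rowLen (i + 1) < μ.rowLen i)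
    (hT : T.entry i (μ.rowLen i - 1) = μ.card) : StandardYoungTableau (μ.eraseCorner i h) where
  entry r j := if (r, j) ∈ μ.eraseCorner i h then T.entry r j else 0
  row_strict {r j₁ j₂} hj hmem := by
    rw [if_pos hmem, if_pos ((μ.eraseCorner i h).up_left_mem le_rfl hj.le hmem)]
    exact T.row_strict hj (YoungDiagram.mem_eraseCorner.1 hmem).1
  col_strict {i₁ i₂ j} hi hmem := by
    rw [if_pos hmem, if_pos ((μ.eraseCorner i h).up_left_mem hi.le le_rfl hmem)]
    exact T.col_strict hi (YoungDiagram.mem_eraseCorner.1 hmem).1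
  bijOn := by
    have hcard := YoungDiagram.card_eraseCorner h
    refine Set.BijOn.congr (f₁ := fun c : ℕ × ℕ => T.entry c.1 c.2) ⟨?_, ?_, ?_⟩
      fun c hc => (if_pos hc).symm
    · intro c hc
      obtain ⟨h1, h2⟩ := YoungDiagram.mem_eraseCorner.1 hc
      have := T.entry_lt_card (YoungDiagram.corner_mem h) hT h1 h2
      exact ⟨(T.bijOn.mapsTo h1).1, Nat.le_of_lt_succ (this.trans_eq hcard.symm)⟩
    · exact T.bijOn.injOn.mono fun c hc => (YoungDiagram.mem_eraseCorner.1 hc).1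
    · rintro m ⟨h1, h2⟩
      obtain ⟨c, hc, rfl⟩ := T.bijOn.surjOn (⟨h1, by omega⟩ : m ∈ Set.Icc 1 μ.card)
      refine ⟨c, YoungDiagram.mem_eraseCorner.2 ⟨hc, ?_⟩, rfl⟩
      rintro rfl
      simp only at h2
      omega
  zeros hmem := if_neg hmem

/-- Adding the largest entry at a corner. -/
def insertMax {i : ℕ} (h : μ.rowLen (i + 1) < μ.rowLen i)
    (S : StandardYoungTableau (μ.eraseCorner i h)) : StandardYoungTableau μ where
  entry r j := if (r, j) = (i, μ.rowLen i - 1) then μ.card else S.entry r j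
  row_strict {r j₁ j₂} hj hmem := by
    have hcard := YoungDiagram.card_eraseCorner h
    have h1 : (r, j₁) ≠ (i, μ.rowLen i - 1) := by
      rintro ⟨rfl, rfl⟩
      have := YoungDiagram.mem_iff_lt_rowLen.1 hmem
      omega
    have h2 : (r, j₁) ∈ μ.eraseCorner i h :=
      YoungDiagram.mem_eraseCorner.2 ⟨μ.up_left_mem le_rfl hj.le hmem, h1⟩
    rw [if_neg h1]
    split_ifs with h3
    · have := S.entry_le_card h2
      simp only at this
      omega
    · exact S.row_strict hj (YoungDiagram.mem_eraseCorner.2 ⟨hmem, h3⟩)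
  col_strict {i₁ i₂ j} hi hmem := by
    have hcard := YoungDiagram.card_eraseCorner h
    have h1 : (i₁, j) ≠ (i, μ.rowLen i - 1) := by
      intro hc
      obtain ⟨h2, h3⟩ := Prod.mk.inj hc
      have h4 := YoungDiagram.mem_iff_lt_rowLen.1 hmem
      have h5 := μ.rowLen_anti (i + 1) i₂ (h2 ▸ hi)
      omega
    have h2 : (i₁, j) ∈ μ.eraseCorner i h :=
      YoungDiagram.mem_eraseCorner.2 ⟨μ.up_left_mem hi.le le_rfl hmem, h1⟩
    rw [if_neg h1]
    split_ifs with h3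
    · have := S.entry_le_card h2
      simp only at this
      omega
    · exact S.col_strict hi (YoungDiagram.mem_eraseCorner.2 ⟨hmem, h3⟩)
  bijOn := by
    have hcard := YoungDiagram.card_eraseCorner h
    have h1 : (μ.cells : Set (ℕ × ℕ)) =
        insert (i, μ.rowLen i - 1) ((μ.eraseCorner i h).cells : Set (ℕ × ℕ)) := by
      rw [← Finset.coe_insert]
      exact congrArg _ (Finset.insert_erase (YoungDiagram.corner_mem h)).symm
    have h2 : Set.Icc 1 μ.card = insert μ.card (Set.Icc 1 (μ.eraseCorner i h).card) := by
      ext m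
      simp only [Set.mem_Icc, Set.mem_insert_iff]
      omega
    have h3 := S.bijOn.congr (f₂ := fun c : ℕ × ℕ =>
        if (c.1, c.2) = (i, μ.rowLen i - 1) then μ.card else S.entry c.1 c.2)
      fun c hc => (if_neg (YoungDiagram.mem_eraseCorner.1 hc).2).symm
    rw [h1, h2]
    have h4 := h3.insert (a := (i, μ.rowLen i - 1)) (by
      simp only [if_true, Set.mem_Icc]
      omega)
    simpa only [if_true] using h4
  zeros {r j} hmem := by
    rw [if_neg, S.zeros]
    · exact fun hc => hmem (YoungDiagram.mem_eraseCorner.1 hc).1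
    · intro hc
      exact hmem (hc ▸ YoungDiagram.corner_mem h)

/-- Standard Young tableaux with the largest entry at a given corner correspond to the standard
Young tableaux of the diagram without that corner. -/
def eraseMaxEquiv {i : ℕ} (h : μ.rowLen (i + 1) < μ.rowLen i) :
    {T : StandardYoungTableau μ // T.entry i (μ.rowLen i - 1) = μ.card} ≃
      StandardYoungTableau (μ.eraseCorner i h) where
  toFun T := T.1.eraseMax h T.2
  invFun S := ⟨insertMax h S, if_pos rfl⟩
  left_inv T := by
    refine Subtype.ext (StandardYoungTableau.ext ?_)
    funext r j
    by_cases h1 : (r, j) = (i, μ.rowLen i - 1)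
    · refine (if_pos h1).trans ?_
      rw [Prod.mk.injEq] at h1
      rw [h1.1, h1.2, T.2]
    · refine (if_neg h1).trans ?_
      by_cases h2 : (r, j) ∈ μ
      · exact if_pos (YoungDiagram.mem_eraseCorner.2 ⟨h2, h1⟩)
      · rw [T.1.zeros h2]
        exact if_neg fun hc => h2 (YoungDiagram.mem_eraseCorner.1 hc).1
  right_inv S := by
    refine StandardYoungTableau.ext ?_
    funext r j
    by_cases h1 : (r, j) ∈ μ.eraseCorner i h
    · exact (if_pos h1).trans (if_neg (YoungDiagram.mem_eraseCorner.1 h1).2)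
    · exact (if_neg h1).trans (S.zeros h1).symm

instance : Finite (StandardYoungTableau μ) := by
  let f : StandardYoungTableau μ → (μ.cells → Fin (μ.card + 1)) := fun T c =>
    ⟨T.entry c.1.1 c.1.2, Nat.lt_succ_of_le (T.entry_le_card c.2)⟩
  refine Finite.of_injective f fun T T' h => StandardYoungTableau.ext ?_
  funext i j
  by_cases hc : (i, j) ∈ μ
  · exact congrArg Fin.val (congrFun h ⟨(i, j), hc⟩)
  · rw [T.zeros hc, T'.zeros hc]

open Classical in
/-- The branching rule for standard Young tableaux. -/
theorem card_eq_sum_eraseCorner (hμ : 0 < μ.card) {k : ℕ} (hk : μ.rowLen k = 0) :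
    Nat.card (StandardYoungTableau μ) = ∑ i : Fin k,
      if h : μ.rowLen (i + 1) < μ.rowLen i then
        Nat.card (StandardYoungTableau (μ.eraseCorner i h)) else 0 := by
  -- Fibre the tableaux by the row of their largest entry. A fibre is empty unless its row ends in a
  -- corner.
  have hex : ∀ T : StandardYoungTableau μ, ∃ i : Fin k,
      μ.rowLen (i + 1) < μ.rowLen i ∧ T.entry i (μ.rowLen i - 1) = μ.card := by
    intro T
    obtain ⟨c, hc, hT⟩ := T.exists_entry_eq_card hμ
    obtain ⟨h1, h2⟩ := T.corner_of_entry_eq_card hc hT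
    refine ⟨⟨c.1, YoungDiagram.fst_lt_of_mem hk hc⟩, h1, ?_⟩
    rw [h2] at hT
    exact hT
  choose row hrow using hex
  have huniq : ∀ (T : StandardYoungTableau μ) (i : Fin k), μ.rowLen (i + 1) < μ.rowLen i →
      T.entry i (μ.rowLen i - 1) = μ.card → row T = i := by
    intro T i h1 h2
    have := T.bijOn.injOn (YoungDiagram.corner_mem (hrow T).1) (YoungDiagram.corner_mem h1)
      ((hrow T).2.trans h2.symm)
    exact Fin.ext (congrArg Prod.fst this)
  rw [← Nat.card_congr (Equiv.sigmaFiberEquiv row), Nat.card_sigma]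
  refine Finset.sum_congr rfl fun i _ => ?_
  split_ifs with h
  · rw [← Nat.card_congr (eraseMaxEquiv h)]
    refine Nat.card_congr (Equiv.subtypeEquivRight fun T => ⟨?_, huniq T i h⟩)
    rintro rfl
    exact (hrow T).2
  · have : IsEmpty {T : StandardYoungTableau μ // row T = i} :=
      ⟨fun T => h (T.2 ▸ (hrow T.1).1)⟩
    exact Nat.card_of_isEmpty

theorem card_of_card_eq_zero (hμ : μ.card = 0) : Nat.card (StandardYoungTableau μ) = 1 := by
  have hmem : ∀ c, c ∉ μ := by
    intro c hc
    rw [YoungDiagram.card, Finset.card_eq_zero] at hμ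
    rw [← YoungDiagram.mem_cells, hμ] at hc
    simp at hc
  rw [Nat.card_eq_one_iff_unique]
  constructor
  · refine ⟨fun T T' => StandardYoungTableau.ext ?_⟩
    funext i j
    rw [T.zeros (hmem _), T'.zeros (hmem _)]
  · refine ⟨⟨fun _ _ => 0, fun _ h => absurd h (hmem _), fun _ h => absurd h (hmem _), ?_,
      fun _ => rfl⟩⟩
    rw [YoungDiagram.card, Finset.card_eq_zero] at hμ
    simp [YoungDiagram.card, hμ]

end StandardYoungTableau

/-! ### Frobenius' formula. -/

/-- The row lengths of a diagram with at most `k` rows, listed from bottom to top and made strictly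
increasing by adding `0, 1, …, k - 1`. -/
def YoungDiagram.shiftedRowLen (μ : YoungDiagram) (k : ℕ) (i : Fin k) : ℕ :=
  μ.rowLen i.rev + i

/-- Erasing the corner lowers just one shifted row length by 1, and
`descFactorial_div_factorial_pred` turns this into the weight on row `i`. -/
theorem frobeniusMatrix_updateRow_eraseCorner {μ : YoungDiagram} {k : ℕ} (i : Fin k)
    (h : μ.rowLen (i.rev + 1) < μ.rowLen i.rev) :
    ((frobeniusMatrix (μ.shiftedRowLen k)).updateRow i fun j =>
      ((μ.shiftedRowLen k i : ℚ) - j) * frobeniusMatrix (μ.shiftedRowLen k) i j) =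
      frobeniusMatrix ((μ.eraseCorner i.rev h).shiftedRowLen k) := by
  ext r j
  have hl : (μ.eraseCorner i.rev h).shiftedRowLen k r =
      (if (r.rev : ℕ) = i.rev then μ.rowLen i.rev - 1 else μ.rowLen r.rev) + r := by
    rw [YoungDiagram.shiftedRowLen, YoungDiagram.rowLen_eraseCorner]
  rw [frobeniusMatrix_apply _ r j, hl]
  by_cases hr : r = i
  · subst hr
    rw [Matrix.updateRow_self, if_pos rfl, descFactorial_div_factorial_pred, frobeniusMatrix_apply,
      show μ.rowLen r.rev - 1 + r + 1 = μ.shiftedRowLen k r by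
        rw [YoungDiagram.shiftedRowLen]; omega]
    congr 2
    rw [YoungDiagram.shiftedRowLen]
    push_cast [Nat.cast_sub (show 1 ≤ μ.rowLen r.rev by omega)]
    ring
  · rw [Matrix.updateRow_ne hr, if_neg]
    · rfl
    · exact fun h => hr (Fin.rev_injective (Fin.ext h))

/-- Rows without a corner contribute nothing. For `i = 0` the diagram row is empty and the weighted
matrix row is zero; otherwise two diagram rows have equal length, and lowering `l i` by 1 makes it
equal to `l (i - 1)`, so two matrix rows agree. -/
theorem det_frobeniusMatrix_updateRow_eq_zero {μ : YoungDiagram} {k : ℕ} (hk : μ.rowLen k = 0)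
    (i : Fin k) (h : μ.rowLen i.rev ≤ μ.rowLen (i.rev + 1)) :
    ((frobeniusMatrix (μ.shiftedRowLen k)).updateRow i fun j =>
      ((μ.shiftedRowLen k i : ℚ) - j) * frobeniusMatrix (μ.shiftedRowLen k) i j).det = 0 := by
  obtain ⟨i, hi⟩ := i
  rw [Fin.val_rev] at h
  change μ.rowLen (k - (i + 1)) ≤ μ.rowLen (k - (i + 1) + 1) at h
  cases i with
  | zero =>
    rw [show k - (0 + 1) + 1 = k by omega, hk] at h
    refine Matrix.det_eq_zero_of_row_eq_zero ⟨0, hi⟩ fun j => ?_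
    have h0 : μ.shiftedRowLen k ⟨0, hi⟩ = 0 := by
      simp only [YoungDiagram.shiftedRowLen, Fin.val_rev]
      omega
    rw [Matrix.updateRow_self, frobeniusMatrix_apply, h0]
    rcases Nat.eq_zero_or_pos (j : ℕ) with hj | hj
    · simp [hj]
    · simp [Nat.descFactorial_eq_zero_iff_lt.2 hj]
  | succ i =>
    have h' := μ.rowLen_anti (k - (i + 1 + 1)) (k - (i + 1 + 1) + 1) (by omega)
    have hne : (⟨i + 1, hi⟩ : Fin k) ≠ ⟨i, by omega⟩ := by simp
    refine Matrix.det_zero_of_row_eq hne ?_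
    rw [Matrix.updateRow_self, Matrix.updateRow_ne hne.symm]
    ext j
    have hl : μ.shiftedRowLen k ⟨i + 1, hi⟩ = μ.shiftedRowLen k ⟨i, by omega⟩ + 1 := by
      simp only [YoungDiagram.shiftedRowLen, Fin.val_rev]
      rw [show k - (i + 1) = k - (i + 1 + 1) + 1 by omega]
      omega
    rw [frobeniusMatrix_apply, frobeniusMatrix_apply, hl,
      descFactorial_div_factorial_pred (μ.shiftedRowLen k _)]
    push_cast
    rfl

/-- **Frobenius' formula** for the number of standard Young tableaux of a given shape. -/
theorem card_standardYoungTableau_eq_det {μ : YoungDiagram} {k : ℕ} (hk : μ.rowLen k = 0) :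
    (Nat.card (StandardYoungTableau μ) : ℚ) =
      μ.card.factorial * (frobeniusMatrix (μ.shiftedRowLen k)).det := by
  -- The size `k` stays fixed; rows that become empty are kept in the matrix.
  induction hN : μ.card generalizing μ with
  | zero =>
    rw [StandardYoungTableau.card_of_card_eq_zero hN]
    have : μ.shiftedRowLen k = fun i : Fin k => (i : ℕ) := by
      funext i
      have h := YoungDiagram.card_eq_sum_rowLen hk
      rw [hN, eq_comm, Finset.sum_eq_zero_iff] at h
      rw [YoungDiagram.shiftedRowLen, h _ (Finset.mem_range.2 i.rev.2), zero_add]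
    rw [this, det_frobeniusMatrix_val]
    simp
  | succ N ih =>
    -- The shifts cancel, so the factor in the branching rule is the number of cells, which is what
    -- (N + 1)! has over N!.
    have hsum : ∑ i, ((μ.shiftedRowLen k i : ℚ) - i) = (N + 1 : ℕ) := by
      rw [← hN, YoungDiagram.card_eq_sum_rowLen hk, ← Fin.sum_univ_eq_sum_range,
        ← Equiv.sum_comp Fin.revPerm]
      push_cast
      refine Finset.sum_congr rfl fun i _ => ?_
      rw [YoungDiagram.shiftedRowLen]
      push_cast
      rw [add_sub_cancel_right, Fin.revPerm_apply, Fin.rev_rev]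
    have hbranch := sum_det_frobeniusMatrix_updateRow (μ.shiftedRowLen k)
    rw [hsum] at hbranch
    rw [StandardYoungTableau.card_eq_sum_eraseCorner (by omega) hk, Nat.factorial_succ,
      mul_comm (N + 1), Nat.cast_mul, mul_assoc, ← hbranch, Finset.mul_sum, Nat.cast_sum,
      ← Equiv.sum_comp Fin.revPerm]
    refine Finset.sum_congr rfl fun i _ => ?_
    rw [Fin.revPerm_apply]
    split_ifs with h
    · rw [frobeniusMatrix_updateRow_eraseCorner i h]
      refine ih ?_ ?_
      · rw [YoungDiagram.rowLen_eraseCorner, if_neg i.rev.2.ne', hk]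
      · have := YoungDiagram.card_eraseCorner h
        omega
    · rw [det_frobeniusMatrix_updateRow_eq_zero hk i (not_lt.1 h)]
      simp

/-! ### The staircase. -/

theorem rowLen_staircase (n i : ℕ) : (staircase n).rowLen i = n - 1 - i := by
  refine eq_of_forall_lt_iff fun j => ?_
  rw [← YoungDiagram.mem_iff_lt_rowLen, mem_staircase]
  simp only
  omega

theorem card_staircase (n : ℕ) : (staircase n).card = n.choose 2 := by
  rw [YoungDiagram.card_eq_sum_rowLen (k := n) (by rw [rowLen_staircase]; omega)]
  simp only [rowLen_staircase]
  rw [Finset.sum_range_reflect (fun i => i) n, Finset.sum_range_id, Nat.choose_two_right]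

theorem card_standardYoungTableau_staircase (n : ℕ) :
    (Nat.card (StandardYoungTableau (staircase n)) : ℚ) =
      ((n.choose 2).factorial : ℚ) /
        ∏ i ∈ Finset.Icc 1 (n - 1), (2 * (i : ℚ) - 1) ^ (n - i) := by
  -- With `n` rows, the last one empty, the `i`-th row from the bottom has length `i`, and the shift
  -- adds another `i`.
  have h : (staircase n).shiftedRowLen n = fun i : Fin n => 2 * (i : ℕ) := by
    funext i
    rw [YoungDiagram.shiftedRowLen, rowLen_staircase, Fin.val_rev]
    omega
  rw [card_standardYoungTableau_eq_det (k := n) (by rw [rowLen_staircase]; omega), card_staircase,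
    h, det_frobeniusMatrix_two_mul, prod_two_pow_mul_factorial_div, div_eq_mul_inv]

theorem mainTheorem4 (n : ℕ) :
    (∃ d : DyckPath n, IsLeast Set.univ d ∧ d.cellsAbove = (staircase n).cells) ∧
    (staircase n).card = n.choose 2 ∧
    Nonempty (MaximalChain (DyckPath n) ≃ StandardYoungTableau (staircase n)) ∧
    Nat.card (MaximalChain (DyckPath n)) = Nat.card (StandardYoungTableau (staircase n)) ∧
    (Nat.card (MaximalChain (DyckPath n)) : ℚ) =
      ((n.choose 2).factorial : ℚ) /
        ∏ i ∈ Finset.Icc 1 (n - 1), (2 * (i : ℚ) - 1) ^ (n - i) := by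
  have e : MaximalChain (DyckPath n) ≃ StandardYoungTableau (staircase n) :=
    (DyckPath.maximalChainEquiv n).trans
      (StandardYoungTableau.equivMaximalChain (staircase n)).symm
  exact ⟨DyckPath.exists_isLeast_cellsAbove_eq n, card_staircase n, ⟨e⟩, Nat.card_congr e,
    by rw [Nat.card_congr e, card_standardYoungTableau_staircase]⟩
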